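/- Let $n,k$ be natural numbers with $3\le k\le (n+1)/2$. Let $\mathcal T=(T,w)$ and $\mathcal T'=(T',w')$ be finite weighted trees with leaf set $\{1,\dots,n\}$, where the edge weights are arbitrary real numbers. Suppose that both trees are essential (they have no vertices of degree $2$) and that all their internal edges have nonzero weight. Here a node is a vertex of degree greater than $2$, the twig of a leaf $F$ is the path from $F$ to the node $N$ such that this path contains no node other than $N$, and an edge is internal if it does not belong to a twig. For a $k$-subset $I$ of $\{1,\dots,n\}$ let $D_I(\mathcal T)$, the $k$-weight, be the sum of the weights of the edges of the minimal subtree of $T$ containing $I$. If $D_I(\mathcal T)=D_I(\mathcal T')$ for every $k$-subset $I$ of $\{1,\dots,n\}$, then $\mathcal T$ and $\mathcal T'$ are isomorphic as weighted trees with labelled leaves: there is a graph isomorphism $\varphi:T\to T'$ with $\varphi(i)=i$ for $i=1,\dots,n$ and $w'(\varphi(e))=w(e)$ for every edge $e$ of $T$. -/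

import Mathlib

/-- A weighted tree on the vertex type `V`: a tree with a real weight on each edge. The finiteness
of the tree is the assumption `[Finite V]` wherever it is used. -/
structure WeightedTree (V : Type*) where
  graph : SimpleGraph V
  isTree : graph.IsTree
  weight : graph.edgeSet → ℝ

namespace WeightedTree

variable {V : Type*} (T : WeightedTree V)

/-- The number of neighbours of a vertex (`V` is finite wherever this is used). -/
noncomputable def deg (v : V) : ℕ := (T.graph.neighborSet v).ncard

/-- A leaf is a vertex of degree `1`. -/
def IsLeaf (v : V) : Prop := T.deg v = 1

/-- A node is a vertex of degree greater than `2`. -/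
def IsNode (v : V) : Prop := 2 < T.deg v

/-- A tree is essential if it has no vertices of degree `2`. -/
def IsEssential : Prop := ∀ v, T.deg v ≠ 2

/-- `p` is the twig associated to the leaf `F`: the path between `F` and a node `N` that contains
no node apart from `N`. -/
def IsTwig {N F : V} (p : T.graph.Walk N F) : Prop :=
  T.IsLeaf F ∧ T.IsNode N ∧ p.IsPath ∧ ∀ v ∈ p.support, T.IsNode v → v = N

/-- An edge is internal if it is not an edge of a twig. -/
def IsInternal (e : T.graph.edgeSet) : Prop :=
  ¬ ∃ (N F : V) (p : T.graph.Walk N F), T.IsTwig p ∧ (e : Sym2 V) ∈ p.edges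

/-- All internal edges have nonzero weight. -/
def IsInternalNonzero : Prop := ∀ e, T.IsInternal e → T.weight e ≠ 0

/-- The weight of a subgraph: the sum of the weights of its edges. -/
noncomputable def subgraphWeight (H : T.graph.Subgraph) : ℝ :=
  ∑ᶠ (e : T.graph.edgeSet) (_ : (e : Sym2 V) ∈ H.edgeSet), T.weight e

/-- The minimal subtree containing `S`: the intersection of all the subtrees that contain `S`. -/
def minSubtree (S : Set V) : T.graph.Subgraph :=
  sInf {H | H.coe.IsTree ∧ S ⊆ H.verts}

/-- For nonempty `S` the subgraph `T.minSubtree S` is indeed the least subtree containing `S`. -/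
theorem isLeast_minSubtree {S : Set V} (hS : S.Nonempty) :
    IsLeast {H : T.graph.Subgraph | H.coe.IsTree ∧ S ⊆ H.verts} (T.minSubtree S) := by
  classical
  have hsub : S ⊆ (T.minSubtree S).verts := by
    intro s hs
    simp only [minSubtree, SimpleGraph.Subgraph.verts_sInf, Set.mem_iInter]
    exact fun H hH => hH.2 hs
  refine ⟨⟨⟨?_, T.isTree.isAcyclic.subgraph _⟩, hsub⟩, fun H hH => sInf_le hH⟩
  rw [← SimpleGraph.Subgraph.connected_iff',
    SimpleGraph.Subgraph.connected_iff_forall_exists_walk_subgraph]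
  refine ⟨hS.mono hsub, fun {u v} hu hv => ?_⟩
  obtain ⟨p, -, huniq⟩ := T.isTree.existsUnique_path u v
  refine ⟨p, le_sInf fun H hH => ?_⟩
  have hle : T.minSubtree S ≤ H := sInf_le hH
  have hc : H.Connected := SimpleGraph.Subgraph.connected_iff'.2 hH.1.connected
  obtain ⟨q, hq⟩ := (H.connected_iff_forall_exists_walk_subgraph.1 hc).2 (hle.1 hu) (hle.1 hv)
  rw [← huniq _ q.bypass_isPath]
  exact SimpleGraph.Walk.toSubgraph_bypass_le_toSubgraph.trans hq

/-- The multiweight `D_S(T)`: the weight of the minimal subtree containing `S`. -/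
noncomputable def multiweight (S : Set V) : ℝ := T.subgraphWeight (T.minSubtree S)

end WeightedTree

/-! An essential tree with labelled leaves is determined by the splits of the leaf set that its
edges induce, so it suffices to recover the weighted splits from the `k`-weights. As each split is
recorded by both parts, `value I` is twice the `k`-weight (`splitSystem_value`), and it equals the
total weight minus twice `avoid I`.

Fix `R` with `k - 2` elements. An alternating sum of four numbers `avoid (R ∪ {a, b})` cancels the
unknown total weight and leaves `quartet R i j x y`, which depends only on how the parts missing `R`
split `i, j, x, y`. If `i, j` lie in different branches at one end of the edge of `A`, `x, y` in
different branches at the other end, and `∅ ≠ R ⊆ Aᶜ`, then only `A` contributes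
(`quartet_of_branching`). If this weight is nonzero, the other system must also separate `ij` from
`xy`; enough such separations force `A` to be one of its parts (`mem_of_displays`). The set `R` is
nonempty because `3 ≤ k`, and it fits into `Aᶜ` beside `x, y` if `k ≤ |Aᶜ|`; since `2k ≤ n + 1`,
this holds for `A` or for its complement.

The same quartets give the internal weights; the pendant weights then follow by exchanging one
element of a `k`-subset (`eq_zero_of_sum_eq_zero`). Finally the tree is rebuilt: a vertex is a
consistent choice of one part from each split (`mem_range_code_iff`), and adjacent vertices differ
in one choice (`adj_iff_code`). -/

/-- A weighted system of pairwise compatible splits of `α`. Each split `A | Aᶜ` is recorded by both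
of its parts. -/
structure SplitSystem (α : Type*) [Fintype α] [DecidableEq α] where
  sets : Finset (Finset α)
  weight : Finset α → ℝ
  compl_mem : ∀ {A}, A ∈ sets → Aᶜ ∈ sets
  weight_compl : ∀ A ∈ sets, weight Aᶜ = weight A
  compat : ∀ {A B}, A ∈ sets → B ∈ sets → A ⊆ B ∨ B ⊆ A ∨ Disjoint A B ∨ Disjoint Aᶜ Bᶜ
  singleton_mem : ∀ i, {i} ∈ sets
  nonempty : ∀ {A}, A ∈ sets → A.Nonempty
  weight_ne_zero : ∀ A ∈ sets, 2 ≤ A.card → 2 ≤ Aᶜ.card → weight A ≠ 0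

/-! ### Split systems: values and quartets. -/

namespace SplitSystem

variable {α : Type*} [Fintype α] [DecidableEq α] (S S' : SplitSystem α)

/-- The total weight of the parts `A` such that `I` meets both `A` and `Aᶜ`. -/
def value (I : Finset α) : ℝ :=
  ∑ A ∈ S.sets, S.weight A * if ¬ Disjoint I A ∧ ¬ Disjoint I Aᶜ then 1 else 0

/-- The total weight of the parts that do not meet `I`. -/
def avoid (I : Finset α) : ℝ :=
  ∑ A ∈ S.sets, S.weight A * if Disjoint I A then 1 else 0

theorem sum_compl (f : Finset α → ℝ) : ∑ A ∈ S.sets, f Aᶜ = ∑ A ∈ S.sets, f A :=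
  Finset.sum_nbij' compl compl (fun _ h => S.compl_mem h) (fun _ h => S.compl_mem h)
    (fun _ _ => compl_compl _) (fun _ _ => compl_compl _) (fun _ _ => rfl)

/-- A nonempty `I` misses at most one of `A` and `Aᶜ`, and both kinds of miss have total weight
`avoid I` by symmetry under complement. -/
theorem value_eq {I : Finset α} (hI : I.Nonempty) :
    S.value I = ∑ A ∈ S.sets, S.weight A - 2 * S.avoid I := by
  have h : S.avoid I = ∑ A ∈ S.sets, S.weight A * if Disjoint I Aᶜ then 1 else 0 := by
    rw [avoid, ← S.sum_compl]
    exact Finset.sum_congr rfl fun A hA => by rw [S.weight_compl A hA]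
  rw [two_mul]
  nth_rewrite 2 [h]
  rw [avoid, value, ← Finset.sum_add_distrib, ← Finset.sum_sub_distrib]
  refine Finset.sum_congr rfl fun A _ => ?_
  obtain ⟨i, hi⟩ := hI
  by_cases h1 : Disjoint I A <;> by_cases h2 : Disjoint I Aᶜ
  · have a := Finset.disjoint_left.1 h1 hi
    have b := Finset.disjoint_left.1 h2 hi
    simp_all
  all_goals simp [h1, h2]

/-- The indicator function of `A`. -/
def ind (A : Finset α) (i : α) : ℝ := if i ∈ A then 1 else 0

theorem avoid_insert_insert (R : Finset α) (i j : α) : S.avoid (insert i (insert j R)) =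
    ∑ A ∈ S.sets, S.weight A * ((if Disjoint R A then 1 else 0) * (1 - ind A i) * (1 - ind A j)) := by
  refine Finset.sum_congr rfl fun A _ => ?_
  simp only [Finset.disjoint_insert_left, ind]
  split_ifs <;> simp_all

/-- The signed weight of the parts that avoid `R` and split `i, j, x, y` as `ij | xy` (positive) or
as `ix | jy` (negative). -/
def quartet (R : Finset α) (i j x y : α) : ℝ :=
  ∑ A ∈ S.sets, S.weight A * ((if Disjoint R A then 1 else 0) * (ind A i - ind A y) *
    (ind A j - ind A x))

/-- With `a = ind A`, the constant and linear terms of the four products `(1 - a _) * (1 - a _)`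
cancel, and the quadratic rest factors as `(a i - a y) * (a j - a x)`. -/
theorem quartet_eq_avoid (R : Finset α) (i j x y : α) : S.quartet R i j x y =
    S.avoid (insert i (insert j R)) + S.avoid (insert x (insert y R)) -
      S.avoid (insert i (insert x R)) - S.avoid (insert j (insert y R)) := by
  simp only [avoid_insert_insert, quartet, ← Finset.sum_add_distrib, ← Finset.sum_sub_distrib]
  exact Finset.sum_congr rfl fun A _ => by ring

variable {S S'}

theorem quartet_congr {k : ℕ} (h : ∀ I : Finset α, I.card = k → S.value I = S'.value I)
    {R : Finset α} (hR : R.card + 2 = k) {i j x y : α} (hi : i ∉ R) (hj : j ∉ R) (hx : x ∉ R)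
    (hy : y ∉ R) (hij : i ≠ j) (hxy : x ≠ y) (hix : i ≠ x) (hjy : j ≠ y) :
    S.quartet R i j x y = S'.quartet R i j x y := by
  -- The total weights of the two systems may differ, so `avoid` agrees only up to a constant; two
  -- plus and two minus signs remove it.
  have key : ∀ a b, a ∉ R → b ∉ R → a ≠ b →
      S.avoid (insert a (insert b R)) - S'.avoid (insert a (insert b R)) =
        (∑ A ∈ S.sets, S.weight A - ∑ A ∈ S'.sets, S'.weight A) / 2 := by
    intro a b ha hb hab
    have h1 := h (insert a (insert b R)) (by
      rw [Finset.card_insert_of_notMem (by simp [ha, hab]), Finset.card_insert_of_notMem hb]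
      exact hR)
    rw [value_eq _ (Finset.insert_nonempty _ _), value_eq _ (Finset.insert_nonempty _ _)] at h1
    linarith
  rw [quartet_eq_avoid, quartet_eq_avoid]
  linarith [key i j hi hj hij, key x y hx hy hxy, key i x hi hx hix, key j y hj hy hjy]

/-! ### Branching pairs and displayed quartets. -/

variable (S) in
/-- No part of the system that is properly contained in `A` contains both `i` and `j`. -/
def Branching (A : Finset α) (i j : α) : Prop :=
  i ∈ A ∧ j ∈ A ∧ ∀ C ∈ S.sets, i ∈ C → j ∈ C → C ⊆ A → C = A

variable (S) in
/-- Some split of the system separates `i, j` from `x, y`. -/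
def Displays (i j x y : α) : Prop := ∃ C ∈ S.sets, i ∈ C ∧ j ∈ C ∧ x ∉ C ∧ y ∉ C

theorem Branching.symm {A : Finset α} {i j : α} (h : S.Branching A i j) : S.Branching A j i :=
  ⟨h.2.1, h.1, fun C hC hj hi => h.2.2 C hC hi hj⟩

theorem Displays.symm {i j x y : α} (h : S.Displays i j x y) : S.Displays x y i j := by
  obtain ⟨C, hC, h⟩ := h
  exact ⟨Cᶜ, S.compl_mem hC, by simp_all⟩

theorem Displays.trans {i j x y z : α} (h : S.Displays i j x y) (h' : S.Displays i j x z) :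
    S.Displays i j y z := by
  obtain ⟨C, hC, hi, hj, hx, hy⟩ := h
  obtain ⟨D, hD, hi', hj', hx', hz⟩ := h'
  rcases S.compat hC hD with h | h | h | h
  · exact ⟨C, hC, hi, hj, hy, fun hz' => hz (h hz')⟩
  · exact ⟨D, hD, hi', hj', fun hy' => hy (h hy'), hz⟩
  · exact absurd hi' (Finset.disjoint_left.1 h hi)
  · exact absurd (Finset.mem_compl.2 hx') (Finset.disjoint_left.1 h (Finset.mem_compl.2 hx))

theorem not_crossing {A C : Finset α} (hA : A ∈ S.sets) (hC : C ∈ S.sets) {i j x y : α}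
    (hi : i ∈ A) (hi' : i ∈ C) (hj : j ∈ A) (hj' : j ∉ C) (hx : x ∉ A) (hx' : x ∈ C)
    (hy : y ∉ A) (hy' : y ∉ C) : False := by
  rcases S.compat hA hC with h | h | h | h
  · exact hj' (h hj)
  · exact hx (h hx')
  · exact Finset.disjoint_left.1 h hi hi'
  · exact Finset.disjoint_left.1 h (Finset.mem_compl.2 hy) (Finset.mem_compl.2 hy')

/-- A maximal part `C` properly inside `A` containing `y, z` is a whole branch below `A`; any `x` in
`A` outside `C` lies in another branch than both. -/
theorem exists_branching_of_not {A : Finset α} (hA : A ∈ S.sets) {y z : α} (hy : y ∈ A)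
    (hz : z ∈ A) (h : ¬ S.Branching A y z) : ∃ x, S.Branching A x y ∧ S.Branching A x z := by
  have hne : (S.sets.filter fun C => y ∈ C ∧ z ∈ C ∧ C ⊂ A).Nonempty := by
    simp only [Branching, not_and, not_forall] at h
    obtain ⟨C, hC, hyC, hzC, hCA, hne⟩ := h hy hz
    exact ⟨C, Finset.mem_filter.2 ⟨hC, hyC, hzC, lt_of_le_of_ne hCA hne⟩⟩
  obtain ⟨C, hC, hmax⟩ := Finset.exists_max_image _ Finset.card hne
  obtain ⟨hCS, hyC, hzC, hCA⟩ := Finset.mem_filter.1 hC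
  obtain ⟨x, hxA, hxC⟩ := Finset.exists_of_ssubset hCA
  obtain ⟨o, ho⟩ := S.nonempty (S.compl_mem hA)
  have ho : o ∉ A := Finset.mem_compl.1 ho
  have key : ∀ D ∈ S.sets, x ∈ D → (y ∈ D ∨ z ∈ D) → D ⊆ A → D = A := by
    intro D hD hxD hyz hDA
    by_contra hne
    rcases S.compat hCS hD with h | h | h | h
    · have hle := hmax D (Finset.mem_filter.2 ⟨hD, h hyC, h hzC, lt_of_le_of_ne hDA hne⟩)
      rw [Finset.eq_of_subset_of_card_le h hle] at hxC
      exact hxC hxD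
    · exact hxC (h hxD)
    · exact hyz.elim (Finset.disjoint_left.1 h hyC) (Finset.disjoint_left.1 h hzC)
    · exact Finset.disjoint_left.1 h (Finset.mem_compl.2 fun h => ho (hCA.1 h))
        (Finset.mem_compl.2 fun h => ho (hDA h))
  exact ⟨x, ⟨hxA, hy, fun D hD hx hy => key D hD hx (.inl hy)⟩,
    ⟨hxA, hz, fun D hD hx hz => key D hD hx (.inr hz)⟩⟩

theorem exists_branching {A : Finset α} (hA : A ∈ S.sets) (h2 : 2 ≤ A.card) :
    ∃ i j, i ≠ j ∧ S.Branching A i j := by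
  obtain ⟨y, hy, z, hz, hyz⟩ := Finset.one_lt_card.1 h2
  by_cases h : S.Branching A y z
  · exact ⟨y, z, hyz, h⟩
  obtain ⟨x, hxy, hxz⟩ := exists_branching_of_not hA hy hz h
  rcases eq_or_ne x y with rfl | hne
  · exact ⟨x, z, hyz, hxz⟩
  · exact ⟨x, y, hne, hxy⟩

theorem eq_of_branching {A C : Finset α} (hA : A ∈ S.sets) (hC : C ∈ S.sets) {i j x y : α}
    (hij : S.Branching A i j) (hxy : S.Branching Aᶜ x y) (hi : i ∈ C) (hj : j ∈ C) (hx : x ∉ C)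
    (hy : y ∉ C) : C = A := by
  rcases S.compat hA hC with h | h | h | h
  · have := hxy.2.2 Cᶜ (S.compl_mem hC) (by simpa) (by simpa) (Finset.compl_subset_compl.2 h)
    exact compl_injective this
  · exact hij.2.2 C hC hi hj h
  · exact absurd hi (Finset.disjoint_left.1 h hij.1)
  · exact absurd (Finset.mem_compl.2 hx) (Finset.disjoint_left.1 h hxy.1)

/-- A part inducing `ij | xy` is `A` or `Aᶜ`, and `Aᶜ` is killed by the nonempty `R`. The pattern
`ix | jy` would cross `A`, and every other pattern makes a factor vanish. -/
theorem quartet_of_branching {A : Finset α} (hA : A ∈ S.sets) {i j x y : α}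
    (hij : S.Branching A i j) (hxy : S.Branching Aᶜ x y) {R : Finset α} (hR : R.Nonempty)
    (hRA : R ⊆ Aᶜ) : S.quartet R i j x y = S.weight A := by
  have hxA := Finset.mem_compl.1 hxy.1
  have hyA := Finset.mem_compl.1 hxy.2.1
  rw [quartet, Finset.sum_eq_single A _ (fun h => absurd hA h)]
  · rw [if_pos (Finset.disjoint_left.2 fun a ha => Finset.mem_compl.1 (hRA ha))]
    simp [ind, hij.1, hij.2.1, hxA, hyA]
  · intro C hC hne
    by_cases hd : Disjoint R C
    · have h1 : ¬ (i ∈ C ∧ j ∈ C ∧ x ∉ C ∧ y ∉ C) := fun ⟨a, b, c, d⟩ =>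
        hne (eq_of_branching hA hC hij hxy a b c d)
      have h2 : ¬ (i ∉ C ∧ j ∉ C ∧ x ∈ C ∧ y ∈ C) := fun ⟨a, b, c, d⟩ => by
        have := eq_of_branching hA (S.compl_mem hC) hij hxy (by simpa) (by simpa) (by simpa)
          (by simpa)
        obtain ⟨r, hr⟩ := hR
        have hrA := hRA hr
        rw [← this, compl_compl] at hrA
        exact Finset.disjoint_left.1 hd hr hrA
      have h3 : ¬ (i ∈ C ∧ j ∉ C ∧ x ∈ C ∧ y ∉ C) := fun ⟨a, b, c, d⟩ =>
        not_crossing hA hC hij.1 a hij.2.1 b hxA c hyA d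
      have h4 : ¬ (i ∉ C ∧ j ∈ C ∧ x ∉ C ∧ y ∈ C) := fun ⟨a, b, c, d⟩ =>
        not_crossing hA hC hij.2.1 b hij.1 a hyA d hxA c
      by_cases a : i ∈ C <;> by_cases b : j ∈ C <;> by_cases c : x ∈ C <;> by_cases d : y ∈ C <;>
        simp_all [ind]
    · simp [hd]

theorem exists_of_quartet_ne_zero {R : Finset α} {i j x y : α} (h : S.quartet R i j x y ≠ 0) :
    S.Displays i j x y ∨ S.Displays i x j y := by
  obtain ⟨C, hC, hne⟩ := Finset.exists_ne_zero_of_sum_ne_zero h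
  have hC' := S.compl_mem hC
  have h1 : ind C i ≠ ind C y := fun h => by simp [h] at hne
  have h2 : ind C j ≠ ind C x := fun h => by simp [h] at hne
  by_cases a : i ∈ C <;> by_cases b : j ∈ C <;> by_cases c : x ∈ C <;> by_cases d : y ∈ C <;>
    simp only [ind, a, b, c, d, if_true, if_false, ne_eq, not_true_eq_false] at h1 h2
  · exact .inl ⟨C, hC, a, b, c, d⟩
  · exact .inr ⟨C, hC, a, c, b, d⟩
  · exact .inr ⟨Cᶜ, hC', by simpa, by simpa, by simpa, by simpa⟩
  · exact .inl ⟨Cᶜ, hC', by simpa, by simpa, by simpa, by simpa⟩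

theorem Displays.not_displays {i j x y : α} (h : S.Displays i x j y) : ¬ S.Displays i y j x := by
  obtain ⟨C, hC, hi, hx, hj, hy⟩ := h
  rintro ⟨D, hD, hi', hy', hj', hx'⟩
  exact not_crossing hC hD hi hi' hx hx' hy hy' hj hj'

/-- Transfers the weight of `A` to quartets of the other system, for both orders of `x, y`: one
order alone cannot tell `ij | xy` from a crossing split. -/
theorem displays_of_branching {k : ℕ} (hk : 3 ≤ k)
    (h : ∀ I : Finset α, I.card = k → S.value I = S'.value I)
    {A : Finset α} (hA : A ∈ S.sets) (hAk : k ≤ Aᶜ.card) {i j x y : α} (hne : i ≠ j)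
    (hne' : x ≠ y) (hij : S.Branching A i j) (hxy : S.Branching Aᶜ x y) :
    ∃ R : Finset α, R.Nonempty ∧ R ⊆ Aᶜ ∧ S'.quartet R i j x y = S.weight A ∧
      S'.quartet R i j y x = S.weight A := by
  have hsub : ({x, y} : Finset α) ⊆ Aᶜ := by
    intro a ha
    rcases Finset.mem_insert.1 ha with rfl | ha
    · exact hxy.1
    · rw [Finset.mem_singleton.1 ha]; exact hxy.2.1
  have hcard : k - 2 ≤ (Aᶜ \ {x, y}).card := by
    rw [Finset.card_sdiff_of_subset hsub, Finset.card_pair hne']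
    omega
  obtain ⟨R, hR, hRc⟩ := Finset.exists_subset_card_eq hcard
  have hRA : R ⊆ Aᶜ := hR.trans Finset.sdiff_subset
  have hRn : R.Nonempty := Finset.card_pos.1 (by omega)
  have hx : x ∉ R := fun hx => by simpa using hR hx
  have hy : y ∉ R := fun hx => by simpa using hR hx
  have hi : i ∉ R := fun hi => Finset.mem_compl.1 (hRA hi) hij.1
  have hj : j ∉ R := fun hi => Finset.mem_compl.1 (hRA hi) hij.2.1
  have hA' : ∀ a ∈ A, ∀ b ∈ Aᶜ, a ≠ b := fun a ha b hb hab => Finset.mem_compl.1 hb (hab ▸ ha)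
  refine ⟨R, hRn, hRA, ?_, ?_⟩
  · rw [← quartet_congr h (by omega) hi hj hx hy hne hne' (hA' _ hij.1 _ hxy.1)
      (hA' _ hij.2.1 _ hxy.2.1), quartet_of_branching hA hij hxy hRn hRA]
  · rw [← quartet_congr h (by omega) hi hj hy hx hne hne'.symm (hA' _ hij.1 _ hxy.2.1)
      (hA' _ hij.2.1 _ hxy.1), quartet_of_branching hA hij hxy.symm hRn hRA]

/-- The parts containing `i` but not `x` form a chain. For each `y` the largest of them missing `y`
contains all of `A`; the smallest one containing `A` then has no further element. -/
theorem mem_of_displays {A : Finset α} (h2 : 2 ≤ A.card) (h2' : 2 ≤ Aᶜ.card)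
    (h : ∀ i ∈ A, ∀ j ∈ A, i ≠ j → ∀ x ∈ Aᶜ, ∀ y ∈ Aᶜ, x ≠ y → S.Displays i j x y) :
    A ∈ S.sets := by
  obtain ⟨i, hi, j, hj, hij⟩ := Finset.one_lt_card.1 h2
  obtain ⟨x, hx, y, hy, hxy⟩ := Finset.one_lt_card.1 h2'
  have chain : ∀ C ∈ S.sets, ∀ D ∈ S.sets, i ∈ C → i ∈ D → x ∉ C → x ∉ D → C ⊆ D ∨ D ⊆ C := by
    intro C hC D hD hi hi' hx hx'
    rcases S.compat hC hD with h | h | h | h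
    · exact .inl h
    · exact .inr h
    · exact absurd hi' (Finset.disjoint_left.1 h hi)
    · exact absurd (Finset.mem_compl.2 hx') (Finset.disjoint_left.1 h (Finset.mem_compl.2 hx))
  have step : ∀ y ∈ Aᶜ, x ≠ y → ∃ C ∈ S.sets, A ⊆ C ∧ x ∉ C ∧ y ∉ C := by
    intro y hy hxy
    obtain ⟨C₀, hC₀, hi₀, -, hx₀, hy₀⟩ := h i hi j hj hij x hx y hy hxy
    obtain ⟨C, hC, hmax⟩ := Finset.exists_max_image
      (S.sets.filter fun C => i ∈ C ∧ x ∉ C ∧ y ∉ C) Finset.card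
      ⟨C₀, Finset.mem_filter.2 ⟨hC₀, hi₀, hx₀, hy₀⟩⟩
    obtain ⟨hCS, hiC, hxC, hyC⟩ := Finset.mem_filter.1 hC
    refine ⟨C, hCS, fun l hl => ?_, hxC, hyC⟩
    rcases eq_or_ne i l with rfl | hil
    · exact hiC
    obtain ⟨D, hD, hiD, hlD, hxD, hyD⟩ := h i hi l hl hil x hx y hy hxy
    have hle := hmax D (Finset.mem_filter.2 ⟨hD, hiD, hxD, hyD⟩)
    rcases chain C hCS D hD hiC hiD hxC hxD with h | h
    · rwa [Finset.eq_of_subset_of_card_le h hle]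
    · exact h hlD
  obtain ⟨C₀, hC₀, hA₀, hx₀, -⟩ := step y hy hxy
  obtain ⟨C, hC, hmin⟩ := Finset.exists_min_image
    (S.sets.filter fun C => A ⊆ C ∧ x ∉ C) Finset.card
    ⟨C₀, Finset.mem_filter.2 ⟨hC₀, hA₀, hx₀⟩⟩
  obtain ⟨hCS, hAC, hxC⟩ := Finset.mem_filter.1 hC
  suffices hCA : C ⊆ A by rwa [hAC.antisymm hCA]
  intro z hz
  by_contra hzA
  have hxz : x ≠ z := fun h => hxC (h ▸ hz)
  obtain ⟨D, hD, hAD, hxD, hzD⟩ := step z (Finset.mem_compl.2 hzA) hxz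
  have hle := hmin D (Finset.mem_filter.2 ⟨hD, hAD, hxD⟩)
  rcases chain C hCS D hD (hAC hi) (hAD hi) hxC hxD with h | h
  · exact hzD (h hz)
  · rw [Finset.eq_of_subset_of_card_le h hle] at hzD
    exact hzD hz

/-! ### Recovering the splits and their weights. -/

theorem mem_of_value_eq_of_le {k : ℕ} (hk : 3 ≤ k)
    (h : ∀ I : Finset α, I.card = k → S.value I = S'.value I)
    {A : Finset α} (hA : A ∈ S.sets) (h2 : 2 ≤ A.card) (hAk : k ≤ Aᶜ.card) : A ∈ S'.sets := by
  have hAc := S.compl_mem hA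
  have h1 : ∀ i j x y, i ≠ j → x ≠ y → S.Branching A i j → S.Branching Aᶜ x y →
      S'.Displays i j x y := by
    intro i j x y hij hxy hb hb'
    obtain ⟨R, -, -, hq, hq'⟩ := displays_of_branching hk h hA hAk hij hxy hb hb'
    have hW := S.weight_ne_zero A hA h2 (by omega)
    by_contra hd
    have hd' : ¬ S'.Displays i j y x := fun ⟨C, hC, a, b, c, d⟩ => hd ⟨C, hC, a, b, d, c⟩
    have e1 := (exists_of_quartet_ne_zero (hq ▸ hW)).resolve_left hd
    have e2 := (exists_of_quartet_ne_zero (hq' ▸ hW)).resolve_left hd'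
    -- Otherwise the two nonzero quartets would force both `ix | jy` and `iy | jx`, which are
    -- incompatible.
    exact e1.not_displays e2
  have h3 : ∀ i j x y, i ≠ j → x ≠ y → S.Branching A i j → x ∈ Aᶜ → y ∈ Aᶜ →
      S'.Displays i j x y := by
    intro i j x y hij hxy hb hx hy
    by_cases hb' : S.Branching Aᶜ x y
    · exact h1 i j x y hij hxy hb hb'
    -- A pair in the same branch is reached through a third point `z` that branches from both.
    obtain ⟨z, hzx, hzy⟩ := exists_branching_of_not hAc hx hy hb'
    rcases eq_or_ne z x with rfl | hne
    · exact h1 i j z y hij hxy hb hzy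
    rcases eq_or_ne z y with rfl | hne'
    · exact h1 i j x z hij hxy hb hzx.symm
    exact (h1 i j z x hij hne hb hzx).trans (h1 i j z y hij hne' hb hzy)
  refine mem_of_displays h2 (by omega) fun i hi j hj hij x hx y hy hxy => ?_
  by_cases hb : S.Branching A i j
  · exact h3 i j x y hij hxy hb hx hy
  obtain ⟨z, hzi, hzj⟩ := exists_branching_of_not hA hi hj hb
  rcases eq_or_ne z i with rfl | hne
  · exact h3 z j x y hij hxy hzj hx hy
  rcases eq_or_ne z j with rfl | hne'
  · exact h3 i z x y hij hxy hzi.symm hx hy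
  exact ((h3 z i x y hne hxy hzi hx hy).symm.trans (h3 z j x y hne' hxy hzj hx hy).symm).symm

theorem mem_of_value_eq {k : ℕ} (hk : 3 ≤ k) (hkn : 2 * k ≤ Fintype.card α + 1)
    (h : ∀ I : Finset α, I.card = k → S.value I = S'.value I)
    {A : Finset α} (hA : A ∈ S.sets) : A ∈ S'.sets := by
  have hc := Finset.card_add_card_compl A
  have p1 := Finset.card_pos.2 (S.nonempty hA)
  have p2 := Finset.card_pos.2 (S.nonempty (S.compl_mem hA))
  by_cases h1 : A.card = 1
  · obtain ⟨i, rfl⟩ := Finset.card_eq_one.1 h1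
    exact S'.singleton_mem i
  by_cases h2 : Aᶜ.card = 1
  · obtain ⟨i, hi⟩ := Finset.card_eq_one.1 h2
    rw [← compl_compl A, hi]
    exact S'.compl_mem (S'.singleton_mem i)
  rcases le_or_gt k Aᶜ.card with hle | hlt
  · exact mem_of_value_eq_of_le hk h hA (by omega) hle
  · rw [← compl_compl A]
    refine S'.compl_mem (mem_of_value_eq_of_le hk h (S.compl_mem hA) (by omega) ?_)
    rw [compl_compl]
    -- If both parts had fewer than `k` elements, then `n ≤ 2k - 2`.
    omega

theorem weight_eq_of_le {k : ℕ} (hk : 3 ≤ k)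
    (h : ∀ I : Finset α, I.card = k → S.value I = S'.value I) (hs : S.sets = S'.sets)
    {A : Finset α} (hA : A ∈ S.sets) (h2 : 2 ≤ A.card) (hAk : k ≤ Aᶜ.card) :
    S.weight A = S'.weight A := by
  obtain ⟨i, j, hij, hb⟩ := exists_branching hA h2
  obtain ⟨x, y, hxy, hb'⟩ := exists_branching (S.compl_mem hA) (by omega)
  obtain ⟨R, hR, hRA, hq, -⟩ := displays_of_branching hk h hA hAk hij hxy hb hb'
  have c1 : S'.Branching A i j := by rw [Branching, ← hs]; exact hb
  have c2 : S'.Branching Aᶜ x y := by rw [Branching, ← hs]; exact hb'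
  rw [← hq, quartet_of_branching (hs ▸ hA) c1 c2 hR hRA]

theorem weight_eq_of_two_le {k : ℕ} (hk : 3 ≤ k) (hkn : 2 * k ≤ Fintype.card α + 1)
    (h : ∀ I : Finset α, I.card = k → S.value I = S'.value I) (hs : S.sets = S'.sets)
    {A : Finset α} (hA : A ∈ S.sets) (h2 : 2 ≤ A.card) (h2' : 2 ≤ Aᶜ.card) :
    S.weight A = S'.weight A := by
  have hc := Finset.card_add_card_compl A
  rcases le_or_gt k Aᶜ.card with hle | hlt
  · exact weight_eq_of_le hk h hs hA h2 hle
  · rw [← S.weight_compl A hA, ← S'.weight_compl A (hs ▸ hA)]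
    refine weight_eq_of_le hk h hs (S.compl_mem hA) h2' ?_
    rw [compl_compl]
    omega

theorem eq_zero_of_sum_eq_zero {k : ℕ} (hk : 1 ≤ k) (hkn : k < Fintype.card α) (c : α → ℝ)
    (h : ∀ I : Finset α, I.card = k → ∑ i ∈ I, c i = 0) (i : α) : c i = 0 := by
  have heq : ∀ j, c j = c i := by
    intro j
    rcases eq_or_ne j i with rfl | hne
    · rfl
    have hcard : k - 1 ≤ (Finset.univ \ {j, i} : Finset α).card := by
      rw [Finset.card_sdiff_of_subset (Finset.subset_univ _), Finset.card_pair hne,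
        Finset.card_univ]
      omega
    obtain ⟨J, hJ, hJc⟩ := Finset.exists_subset_card_eq hcard
    have hj : j ∉ J := fun hj => by simpa using hJ hj
    have hi : i ∉ J := fun hi => by simpa using hJ hi
    have e1 := h (insert j J) (by rw [Finset.card_insert_of_notMem hj]; omega)
    have e2 := h (insert i J) (by rw [Finset.card_insert_of_notMem hi]; omega)
    rw [Finset.sum_insert hj] at e1
    rw [Finset.sum_insert hi] at e2
    linarith
  obtain ⟨I, -, hI⟩ := Finset.exists_subset_card_eq
    (show k ≤ (Finset.univ : Finset α).card by rw [Finset.card_univ]; omega)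
  have := h I hI
  rw [Finset.sum_congr rfl fun j _ => heq j, Finset.sum_const, hI, nsmul_eq_mul] at this
  rcases mul_eq_zero.1 this with h0 | h0
  · rw [Nat.cast_eq_zero] at h0; omega
  · exact h0

theorem weight_singleton_eq {k : ℕ} (hk : 3 ≤ k) (hkn : 2 * k ≤ Fintype.card α + 1)
    (h : ∀ I : Finset α, I.card = k → S.value I = S'.value I) (hs : S.sets = S'.sets) (i : α) :
    S.weight {i} = S'.weight {i} := by
  rw [← sub_eq_zero]
  refine eq_zero_of_sum_eq_zero (k := k) (by omega) (by omega)
    (fun i => S.weight {i} - S'.weight {i}) (fun I hI => ?_) i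
  have h0 : ∑ A ∈ S.sets, (S.weight A - S'.weight A) *
      (if ¬ Disjoint I A ∧ ¬ Disjoint I Aᶜ then 1 else 0) = 0 := by
    have := h I hI
    rw [value, value, ← hs] at this
    simp only [sub_mul, Finset.sum_sub_distrib]
    linarith
  -- Nontrivial splits already have equal weights. At most one of `A, Aᶜ` is a singleton, so `f A +
  -- f Aᶜ` is the full term of `A`.
  set f : Finset α → ℝ := fun A => (S.weight A - S'.weight A) *
      ((if ¬ Disjoint I A ∧ ¬ Disjoint I Aᶜ then 1 else 0) * if A.card = 1 then 1 else 0) with hf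
  have h1 : ∑ A ∈ S.sets, (f A + f Aᶜ) = 0 := by
    rw [← h0]
    refine Finset.sum_congr rfl fun A hA => ?_
    have hc := Finset.card_add_card_compl A
    have p1 := Finset.card_pos.2 (S.nonempty hA)
    have p2 := Finset.card_pos.2 (S.nonempty (S.compl_mem hA))
    simp only [hf, S.weight_compl A hA, S'.weight_compl A (hs ▸ hA), compl_compl,
      and_comm (a := ¬ Disjoint I Aᶜ)]
    by_cases a : A.card = 1
    · have b : Aᶜ.card ≠ 1 := by omega
      simp [a, b]
    by_cases b : Aᶜ.card = 1
    · simp [a, b]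
    · rw [weight_eq_of_two_le hk hkn h hs hA (by omega) (by omega)]
      simp
  rw [Finset.sum_add_distrib, S.sum_compl f] at h1
  have h2 : ∑ A ∈ S.sets, f A = ∑ i, f {i} := by
    rw [← Finset.sum_image (f := f) (s := Finset.univ) (g := fun i : α => {i})
      (fun a _ b _ hab => Finset.singleton_injective hab)]
    symm
    refine Finset.sum_subset (fun A hA => ?_) fun A _ hA => ?_
    · obtain ⟨i, -, rfl⟩ := Finset.mem_image.1 hA
      exact S.singleton_mem i
    · have : A.card ≠ 1 := fun hc => by
        obtain ⟨i, rfl⟩ := Finset.card_eq_one.1 hc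
        exact hA (Finset.mem_image.2 ⟨i, Finset.mem_univ i, rfl⟩)
      simp [hf, this]
  have h3 : ∑ i, f {i} = ∑ i ∈ I, (S.weight {i} - S'.weight {i}) := by
    rw [← Finset.sum_subset (Finset.subset_univ I)]
    · refine Finset.sum_congr rfl fun i hi => ?_
      obtain ⟨j, hj, hji⟩ := Finset.exists_mem_ne (show 1 < I.card by omega) i
      have d : ¬ Disjoint I {i}ᶜ := fun hd =>
        Finset.disjoint_left.1 hd hj (by simpa using hji)
      simp [hf, hi, d]
    · intro i _ hi
      simp [hf, hi]
  linarith

/-- A weighted split system on `n` points is determined by its values on the `k`-subsets if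
`3 ≤ k ≤ (n + 1) / 2`. -/
theorem eq_of_value_eq {k : ℕ} (hk : 3 ≤ k) (hkn : 2 * k ≤ Fintype.card α + 1)
    (h : ∀ I : Finset α, I.card = k → S.value I = S'.value I) :
    S.sets = S'.sets ∧ ∀ A ∈ S.sets, S.weight A = S'.weight A := by
  have hs : S.sets = S'.sets := Finset.Subset.antisymm (fun A hA => mem_of_value_eq hk hkn h hA)
    fun A hA => mem_of_value_eq hk hkn (fun I hI => (h I hI).symm) hA
  refine ⟨hs, fun A hA => ?_⟩
  have p1 := Finset.card_pos.2 (S.nonempty hA)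
  have p2 := Finset.card_pos.2 (S.nonempty (S.compl_mem hA))
  by_cases h1 : A.card = 1
  · obtain ⟨i, rfl⟩ := Finset.card_eq_one.1 h1
    exact weight_singleton_eq hk hkn h hs i
  by_cases h2 : Aᶜ.card = 1
  · obtain ⟨i, hi⟩ := Finset.card_eq_one.1 h2
    rw [← S.weight_compl A hA, ← S'.weight_compl A (hs ▸ hA), hi]
    exact weight_singleton_eq hk hkn h hs i
  exact weight_eq_of_two_le hk hkn h hs hA (by omega) (by omega)

end SplitSystem

/-! ### Sides of an edge in a tree. -/

namespace WeightedTree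

open SimpleGraph

variable {V : Type*} (T : WeightedTree V)

/-- The vertices on the side of `d.fst` once the edge of the dart `d` is removed. -/
def side (d : T.graph.Dart) : Set V := {x | (T.graph.deleteEdges {d.edge}).Reachable d.fst x}

variable {T}

theorem fst_mem_side (d : T.graph.Dart) : d.fst ∈ T.side d := Reachable.refl _

theorem mem_side_of_adj {d : T.graph.Dart} {x y : V} (hx : x ∈ T.side d) (h : T.graph.Adj x y)
    (hne : s(x, y) ≠ d.edge) : y ∈ T.side d :=
  Reachable.trans hx (Adj.reachable (deleteEdges_adj.2 ⟨h, by simpa using hne⟩))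

theorem mem_side_symm {d : T.graph.Dart} {x : V} : x ∈ T.side d.symm ↔ x ∉ T.side d := by
  constructor
  · intro h h'
    have hb := isAcyclic_iff_forall_isBridge.1 T.isTree.isAcyclic d.edge_mem
    have h : (T.graph.deleteEdges {d.edge}).Reachable d.snd x := by
      simpa [side] using h
    exact isBridge_iff.1 hb (Reachable.trans h' h.symm)
  · intro h
    have hr := (reachable_iff_reflTransGen _ _).1 (T.isTree.connected.preconnected d.fst x)
    suffices x ∈ T.side d ∨ x ∈ T.side d.symm from this.resolve_left h
    clear h
    induction hr with
    | refl => exact .inl (fst_mem_side d)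
    | @tail y z _ hyz ih =>
      by_cases he : s(y, z) = d.edge
      · rcases dart_edge_eq_iff ⟨(y, z), hyz⟩ d |>.1 he with h | h
        · right; rw [← h]; exact fst_mem_side _
        · left
          have : d = Dart.symm ⟨(y, z), hyz⟩ := by rw [h, Dart.symm_symm]
          rw [this]; exact fst_mem_side _
      · exact ih.imp (fun h => mem_side_of_adj h hyz he)
          fun h => mem_side_of_adj h hyz (by rwa [Dart.edge_symm])

theorem snd_notMem_side (d : T.graph.Dart) : d.snd ∉ T.side d :=
  mem_side_symm.1 (fst_mem_side d.symm)

/-- A walk inside the side of `d` that starts in the side of `e` could leave the latter only through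
`e.snd`, which it never meets. -/
theorem side_subset {d e : T.graph.Dart} (h : d.fst ∈ T.side e) (h' : e.snd ∉ T.side d) :
    T.side d ⊆ T.side e := by
  intro x hx
  have hr := (reachable_iff_reflTransGen _ _).1 hx
  suffices x ∈ T.side e ∧ x ∈ T.side d from this.1
  clear hx
  induction hr with
  | refl => exact ⟨h, fst_mem_side d⟩
  | @tail y z _ hyz ih =>
    obtain ⟨hyz, hne⟩ := deleteEdges_adj.1 hyz
    have hz : z ∈ T.side d := mem_side_of_adj ih.2 hyz (by simpa using hne)
    refine ⟨mem_side_of_adj ih.1 hyz fun he => ?_, hz⟩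
    rcases dart_edge_eq_iff ⟨(y, z), hyz⟩ e |>.1 he with rfl | h
    · exact h' hz
    · apply h'
      have : e = Dart.symm ⟨(y, z), hyz⟩ := by rw [h, Dart.symm_symm]
      rw [this]
      exact ih.2

theorem side_subset_of_snd_mem {d e : T.graph.Dart} (h : d.snd ∈ T.side e)
    (h' : e.snd ∉ T.side d) : T.side d ⊆ T.side e := by
  refine side_subset (mem_side_of_adj h d.adj.symm fun he => ?_) h'
  rcases dart_edge_eq_iff d.symm e |>.1 he with rfl | he
  · exact h' (fst_mem_side d)
  · have : d = e := Dart.symm_involutive.injective he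
    exact snd_notMem_side d (this ▸ h)

theorem eq_of_mem_side_of_mem_side {d e : T.graph.Dart} (h : d.snd = e.snd) {x : V}
    (hd : x ∈ T.side d) (he : x ∈ T.side e) : d = e := by
  by_contra hne
  refine mem_side_symm.1 (side_subset_of_snd_mem (d := d) (e := e.symm) ?_ ?_ hd) he
  · rw [h]; exact fst_mem_side e.symm
  · refine mem_side_symm.1 (mem_side_of_adj (x := d.snd) (fst_mem_side d.symm) ?_ ?_)
    · rw [h]; exact e.adj.symm
    · rw [Dart.edge_symm]
      intro hed
      have hed : e.edge = d.edge := by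
        rw [← hed, h, ← Dart.edge_symm]; rfl
      rcases dart_edge_eq_iff _ _ |>.1 hed with h1 | h1
      · exact hne h1.symm
      · have h2 : d.snd = d.fst := by rw [h, h1]; rfl
        exact d.adj.ne h2.symm

theorem exists_dart_of_ne {u v : V} (h : u ≠ v) :
    ∃ d : T.graph.Dart, d.fst = u ∧ v ∉ T.side d := by
  obtain ⟨p, hp, -⟩ := T.isTree.existsUnique_path u v
  cases p with
  | nil => exact absurd rfl h
  | @cons _ z _ hadj q =>
    refine ⟨⟨(u, z), hadj⟩, rfl, ?_⟩
    rw [Walk.isPath_def, Walk.support_cons, List.nodup_cons] at hp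
    rw [← mem_side_symm, side]
    refine ⟨q.toDeleteEdges _ fun e he hee => hp.1 ?_⟩
    rw [Set.mem_singleton_iff] at hee
    subst hee
    have he : s(z, u) ∈ q.edges := by simpa using he
    exact q.snd_mem_support_of_mem_edges he

/-- Two sides are nested or disjoint, or together they cover the tree. -/
theorem side_compat (d e : T.graph.Dart) : T.side d ⊆ T.side e ∨ T.side e ⊆ T.side d ∨
    Disjoint (T.side d) (T.side e) ∨ Disjoint (T.side d)ᶜ (T.side e)ᶜ := by
  have hd : ∀ x, x ∈ T.side d.symm ↔ x ∉ T.side d := fun x => mem_side_symm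
  have he : ∀ x, x ∈ T.side e.symm ↔ x ∉ T.side e := fun x => mem_side_symm
  by_cases hde : d.edge = e.edge
  · rcases dart_edge_eq_iff d e |>.1 hde with rfl | rfl
    · exact .inl subset_rfl
    · exact .inr (.inr (.inl (Set.disjoint_left.2 fun x hx => (he x).1 hx)))
  by_cases h1 : d.fst ∈ T.side e
  · by_cases h3 : e.snd ∈ T.side d
    · have h2 : d.snd ∈ T.side e := mem_side_of_adj h1 d.adj hde
      right; right; right
      rw [Set.disjoint_compl_left_iff_subset]
      intro x hx
      by_contra hxd
      exact hx (side_subset (d := d.symm) h2 (by rwa [hd, not_not]) ((hd x).2 hxd))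
    · exact .inl (side_subset h1 h3)
  · by_cases h3 : e.fst ∈ T.side d
    · have h2 : d.snd ∈ T.side e.symm := mem_side_of_adj ((he _).2 h1) d.adj
        (by rwa [Dart.edge_symm])
      right; left
      intro x hx
      by_contra hxd
      exact (he x).1 (side_subset (d := d.symm) (e := e.symm) h2
        (fun h => (hd _).1 h h3) ((hd x).2 hxd)) hx
    · right; right; left
      exact Set.disjoint_left.2 fun x hx =>
        (he x).1 (side_subset (d := d) (e := e.symm) ((he _).2 h1) h3 hx)

section Finite

variable [Finite V]

/-- Walking away from `d.snd` strictly shrinks the side until a leaf is reached. -/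
theorem exists_isLeaf_mem_side (d : T.graph.Dart) : ∃ x ∈ T.side d, T.IsLeaf x := by
  induction hN : (T.side d).ncard using Nat.strong_induction_on generalizing d with
  | _ N ih =>
    by_cases hl : T.IsLeaf d.fst
    · exact ⟨_, fst_mem_side d, hl⟩
    have hpos : 0 < T.deg d.fst := (Set.ncard_pos (Set.toFinite _)).2 ⟨d.snd, d.adj⟩
    obtain ⟨z, hz, hne⟩ := Set.exists_ne_of_one_lt_ncard
      (show 1 < (T.graph.neighborSet d.fst).ncard by unfold IsLeaf deg at *; omega) d.snd
    let e : T.graph.Dart := ⟨(z, d.fst), hz.symm⟩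
    have hsub : T.side e ⊆ T.side d := by
      refine side_subset_of_snd_mem (fst_mem_side d) fun h => hne ?_
      exact congrArg (·.fst) (eq_of_mem_side_of_mem_side (d := e) (e := d.symm) rfl h
        (fst_mem_side d.symm))
    have hlt := Set.ncard_lt_ncard (hsub.ssubset_of_mem_notMem (fst_mem_side d)
      (snd_notMem_side e)) (Set.toFinite _)
    obtain ⟨x, hx, hxl⟩ := ih _ (hN ▸ hlt) e rfl
    exact ⟨x, hsub hx, hxl⟩

/-- If `u` is not a leaf, it has at least three branches; `d.snd` and `e.snd` occupy at most two,
and another branch lies in both sides and contains a leaf. -/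
theorem exists_isLeaf_mem_side_inter (hess : T.IsEssential) {d e : T.graph.Dart} {u : V}
    (hd : u ∈ T.side d) (he : u ∈ T.side e) : ∃ x, x ∈ T.side d ∧ x ∈ T.side e ∧ T.IsLeaf x := by
  by_cases hl : T.IsLeaf u
  · exact ⟨u, hd, he, hl⟩
  have hu : u ≠ d.snd := fun h => snd_notMem_side d (h ▸ hd)
  obtain ⟨c, rfl, -⟩ := exists_dart_of_ne (T := T) hu
  have hpos : 0 < T.deg c.fst := (Set.ncard_pos (Set.toFinite _)).2 ⟨c.snd, c.adj⟩
  have h2 := hess c.fst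
  have h3 : 2 < (T.graph.neighborSet c.fst).ncard := by unfold IsLeaf deg at *; omega
  suffices ∃ f : T.graph.Dart, f.snd = c.fst ∧ d.snd ∉ T.side f ∧ e.snd ∉ T.side f by
    obtain ⟨f, hf, h1, h2⟩ := this
    obtain ⟨x, hx, hxl⟩ := exists_isLeaf_mem_side f
    exact ⟨x, side_subset_of_snd_mem (hf ▸ hd) h1 hx, side_subset_of_snd_mem (hf ▸ he) h2 hx, hxl⟩
  by_contra! hcon
  obtain ⟨x, hx, y, hy, z, hz, hxy, hxz, hyz⟩ := (Set.two_lt_ncard (Set.toFinite _)).1 h3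
  have key : ∀ (w : V) (a b : V) (ha : T.graph.Adj c.fst a) (hb : T.graph.Adj c.fst b),
      w ∈ T.side ⟨(a, c.fst), ha.symm⟩ → w ∈ T.side ⟨(b, c.fst), hb.symm⟩ → a = b :=
    fun w a b ha hb h h' => congrArg (·.fst)
      (eq_of_mem_side_of_mem_side (d := ⟨(a, c.fst), ha.symm⟩) (e := ⟨(b, c.fst), hb.symm⟩) rfl h h')
  have kd := key d.snd
  have ke := key e.snd
  have cx := hcon ⟨(x, c.fst), hx.symm⟩ rfl
  have cy := hcon ⟨(y, c.fst), hy.symm⟩ rfl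
  have cz := hcon ⟨(z, c.fst), hz.symm⟩ rfl
  by_cases ax : d.snd ∈ T.side ⟨(x, c.fst), hx.symm⟩
  · have ay := cy fun h => hxy (kd _ _ hx hy ax h)
    have az := cz fun h => hxz (kd _ _ hx hz ax h)
    exact hyz (ke _ _ hy hz ay az)
  · have bx := cx ax
    have ay : d.snd ∈ T.side ⟨(y, c.fst), hy.symm⟩ := by
      by_contra h; exact hxy (ke _ _ hx hy bx (cy h))
    have az : d.snd ∈ T.side ⟨(z, c.fst), hz.symm⟩ := by
      by_contra h; exact hxz (ke _ _ hx hz bx (cz h))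
    exact hyz (kd _ _ hy hz ay az)

end Finite

/-! ### The multiweight as a sum over darts. -/

theorem edge_mem_edges_of_mem_side {d : T.graph.Dart} {s t : V} (p : T.graph.Walk s t)
    (hs : s ∈ T.side d) (ht : t ∉ T.side d) : d.edge ∈ p.edges := by
  obtain ⟨e, he, h1, h2⟩ := p.exists_boundary_dart _ hs ht
  by_contra h
  refine h2 (mem_side_of_adj h1 e.adj fun hed => h ?_)
  rw [← hed]
  exact List.mem_map_of_mem (f := Dart.edge) he

theorem induce_side_isTree (d : T.graph.Dart) :
    ((⊤ : T.graph.Subgraph).induce (T.side d)).coe.IsTree := by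
  refine ⟨?_, T.isTree.isAcyclic.subgraph _⟩
  rw [connected_iff_exists_forall_reachable]
  refine ⟨⟨d.fst, fst_mem_side d⟩, ?_⟩
  rintro ⟨x, hx⟩
  have hr := (reachable_iff_reflTransGen _ _).1 (show Reachable _ _ _ from hx)
  induction hr with
  | refl => exact Reachable.refl _
  | @tail y z hy hyz ih =>
    have hy' : y ∈ T.side d := (reachable_iff_reflTransGen _ _).2 hy
    refine (ih hy').trans (Adj.reachable ?_)
    exact ⟨hy', hx, (deleteEdges_adj.1 hyz).1⟩

/-- A side is itself a subtree without the edge, so `S` cannot lie in one side; conversely a walk in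
the subtree between both sides must cross the edge. -/
theorem edge_mem_minSubtree_iff {S : Set V} (hS : S.Nonempty) (d : T.graph.Dart) :
    d.edge ∈ (T.minSubtree S).edgeSet ↔ (∃ s ∈ S, s ∈ T.side d) ∧ ∃ s ∈ S, s ∉ T.side d := by
  constructor
  · intro h
    have key : ∀ e : T.graph.Dart, e.edge = d.edge → ¬ S ⊆ T.side e := by
      intro e he hSe
      have hle : T.minSubtree S ≤ (⊤ : T.graph.Subgraph).induce (T.side e) :=
        sInf_le ⟨induce_side_isTree e, hSe⟩
      have := Subgraph.edgeSet_mono hle h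
      rw [← he] at this
      have hadj : ((⊤ : T.graph.Subgraph).induce (T.side e)).Adj e.fst e.snd := this
      exact snd_notMem_side e hadj.snd_mem
    constructor
    · obtain ⟨s, hs, h1⟩ := Set.not_subset.1 (key d.symm d.edge_symm)
      exact ⟨s, hs, by rwa [mem_side_symm, not_not] at h1⟩
    · exact Set.not_subset.1 (key d rfl)
  · rintro ⟨⟨s, hs, hsd⟩, t, ht, htd⟩
    obtain ⟨⟨htree, hsub⟩, -⟩ := T.isLeast_minSubtree hS
    have hc : (T.minSubtree S).Connected := Subgraph.connected_iff'.2 htree.connected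
    obtain ⟨q, hq⟩ := ((Subgraph.connected_iff_forall_exists_walk_subgraph _).1 hc).2
      (hsub hs) (hsub ht)
    refine Subgraph.edgeSet_mono hq ?_
    rw [Walk.mem_edges_toSubgraph]
    exact edge_mem_edges_of_mem_side q hsd htd

/-- The weight of the edge of a dart. -/
def dartWeight (d : T.graph.Dart) : ℝ := T.weight ⟨d.edge, d.edge_mem⟩

theorem dartWeight_symm (d : T.graph.Dart) : dartWeight d.symm = dartWeight d := by
  simp only [dartWeight, Dart.edge_symm]

open Classical in
theorem two_mul_multiweight [Fintype V] {S : Set V} (hS : S.Nonempty) :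
    2 * T.multiweight S = ∑ d : T.graph.Dart, dartWeight d *
      if (∃ s ∈ S, s ∈ T.side d) ∧ ∃ s ∈ S, s ∉ T.side d then 1 else 0 := by
  have h1 : T.multiweight S = ∑ e : T.graph.edgeSet, T.weight e *
      if (e : Sym2 V) ∈ (T.minSubtree S).edgeSet then 1 else 0 := by
    rw [multiweight, subgraphWeight, finsum_eq_sum_of_fintype]
    refine Finset.sum_congr rfl fun e _ => ?_
    rw [finsum_eq_if, mul_ite, mul_one, mul_zero]
  have h2 := Finset.sum_fiberwise Finset.univ
    (fun d : T.graph.Dart => (⟨d.edge, d.edge_mem⟩ : T.graph.edgeSet)) fun d => dartWeight d *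
      if (∃ s ∈ S, s ∈ T.side d) ∧ ∃ s ∈ S, s ∉ T.side d then (1 : ℝ) else 0
  rw [← h2, h1, Finset.mul_sum]
  refine Finset.sum_congr rfl fun e _ => ?_
  have h3 := T.graph.dart_edge_fiber_card e.1 e.2
  rw [Finset.sum_congr rfl (g := fun _ => T.weight e *
      if (e : Sym2 V) ∈ (T.minSubtree S).edgeSet then (1 : ℝ) else 0), Finset.sum_const,
      nsmul_eq_mul]
  · congr 1
    have : (Finset.univ.filter fun d : T.graph.Dart =>
      (⟨d.edge, d.edge_mem⟩ : T.graph.edgeSet) = e).card = 2 := by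
      rw [← h3]
      congr 1
      ext d
      simp [Subtype.ext_iff]
    rw [this, Nat.cast_two]
  · intro d hd
    obtain rfl := (Finset.mem_filter.1 hd).2
    simp only [edge_mem_minSubtree_iff hS]
    rfl

end WeightedTree

/-! ### From trees to split systems. -/

namespace WeightedTree

open SimpleGraph

variable {V : Type*} {T : WeightedTree V} {n : ℕ} (leaf : Fin n ≃ {v : V // T.IsLeaf v})

theorem mem_side_iff_eq_of_isLeaf {d : T.graph.Dart} (h : T.IsLeaf d.fst) {x : V} :
    x ∈ T.side d ↔ x = d.fst := by
  refine ⟨fun hx => ?_, fun hx => hx ▸ fst_mem_side d⟩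
  by_contra hne
  obtain ⟨e, he, hxe⟩ := exists_dart_of_ne (T := T) (Ne.symm hne)
  obtain ⟨z, hz⟩ := Set.ncard_eq_one.1 (show (T.graph.neighborSet d.fst).ncard = 1 from h)
  have h1 : d.snd ∈ T.graph.neighborSet d.fst := d.adj
  have h2 : e.snd ∈ T.graph.neighborSet d.fst := he ▸ e.adj
  rw [hz, Set.mem_singleton_iff] at h1 h2
  have : e = d := Dart.ext _ _ (Prod.ext he (h2.trans h1.symm))
  exact hxe (this ▸ hx)

/-- An inner vertex of the path has degree at least `2`, hence at least `3`, so it would be a second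
node. -/
theorem IsEssential.eq_mk_of_mem_edges_of_isTwig [Finite V] (hess : T.IsEssential) {N F : V}
    {p : T.graph.Walk N F} (hp : T.IsTwig p) {e : Sym2 V} (he : e ∈ p.edges) : e = s(N, F) := by
  obtain ⟨-, -, hpath, hnode⟩ := hp
  cases p with
  | nil => simp at he
  | @cons _ v _ h q =>
    rw [Walk.cons_isPath_iff] at hpath
    cases q with
    | nil => simpa using he
    | @cons _ w _ h' r =>
      exfalso
      have hvN : v ≠ N := h.ne'
      have hwN : N ≠ w := fun hw => hpath.2 (by simp [hw])
      have hdeg : 1 < T.deg v := (Set.one_lt_ncard (Set.toFinite _)).2 ⟨N, h.symm, w, h', hwN⟩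
      have h2 := hess v
      exact hvN (hnode v (by simp) (show 2 < T.deg v by omega))

open Classical in
/-- The labels of the leaves on the side of `d.fst`. -/
noncomputable def leafSet (d : T.graph.Dart) : Finset (Fin n) :=
  Finset.univ.filter fun i => (leaf i : V) ∈ T.side d

theorem mem_leafSet {d : T.graph.Dart} {i : Fin n} :
    i ∈ leafSet leaf d ↔ (leaf i : V) ∈ T.side d := by
  simp [leafSet]

theorem leafSet_symm (d : T.graph.Dart) : leafSet leaf d.symm = (leafSet leaf d)ᶜ := by
  ext i
  rw [Finset.mem_compl, mem_leafSet, mem_leafSet, mem_side_symm]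

theorem leafSet_of_fst_eq {d : T.graph.Dart} {i : Fin n} (h : d.fst = leaf i) :
    leafSet leaf d = {i} := by
  ext j
  rw [mem_leafSet, mem_side_iff_eq_of_isLeaf (h ▸ (leaf i).2), h, Finset.mem_singleton]
  exact ⟨fun h => leaf.injective (Subtype.ext h), fun h => h ▸ rfl⟩

theorem exists_fst_eq (i : Fin n) : ∃ d : T.graph.Dart, d.fst = leaf i := by
  obtain ⟨z, hz⟩ := Set.ncard_eq_one.1
    (show (T.graph.neighborSet (leaf i : V)).ncard = 1 from (leaf i).2)
  have h : z ∈ T.graph.neighborSet (leaf i : V) := hz ▸ rfl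
  exact ⟨⟨(leaf i, z), h⟩, rfl⟩

section

variable [Finite V]

theorem leafSet_nonempty (d : T.graph.Dart) : (leafSet leaf d).Nonempty := by
  obtain ⟨x, hx, hl⟩ := exists_isLeaf_mem_side d
  exact ⟨leaf.symm ⟨x, hl⟩, by rwa [mem_leafSet, Equiv.apply_symm_apply]⟩

theorem leafSet_inter_nonempty (hess : T.IsEssential) {d e : T.graph.Dart} {u : V}
    (hd : u ∈ T.side d) (he : u ∈ T.side e) : (leafSet leaf d ∩ leafSet leaf e).Nonempty := by
  obtain ⟨x, hx, hx', hl⟩ := exists_isLeaf_mem_side_inter hess hd he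
  exact ⟨leaf.symm ⟨x, hl⟩, by simp [mem_leafSet, hx, hx']⟩

/-- A vertex in one side but not in the other would yield a leaf with the same property, by
`leafSet_inter_nonempty`. -/
theorem leafSet_injective (hess : T.IsEssential) : Function.Injective (leafSet leaf) := by
  have key : ∀ d e : T.graph.Dart, leafSet leaf d = leafSet leaf e → T.side d ⊆ T.side e := by
    intro d e h u hu
    by_contra hue
    have := leafSet_inter_nonempty leaf hess hu (mem_side_symm.2 hue)
    rw [leafSet_symm, h, Finset.inter_compl] at this
    exact Finset.not_nonempty_empty this
  intro d e h
  have hs := (key d e h).antisymm (key e d h.symm)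
  by_cases he : d.edge = e.edge
  · rcases dart_edge_eq_iff d e |>.1 he with rfl | rfl
    · rfl
    · exact absurd (hs ▸ fst_mem_side e.symm) (snd_notMem_side e)
  · have := mem_side_of_adj (hs ▸ fst_mem_side d) d.adj he
    exact absurd (hs ▸ this) (snd_notMem_side d)

end

section SplitSystem

variable [Fintype V] (hess : T.IsEssential) (hnz : T.IsInternalNonzero)

open Classical in
/-- The split system of an essential weighted tree with labelled leaves. -/
noncomputable def splitSystem : SplitSystem (Fin n) where
  sets := Finset.univ.image (leafSet leaf)
  -- Weights are read only on members of `sets`, so the default `0` plays no role.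
  weight := Function.extend (leafSet leaf) dartWeight 0
  compl_mem := by
    intro A hA
    obtain ⟨d, -, rfl⟩ := Finset.mem_image.1 hA
    exact Finset.mem_image.2 ⟨d.symm, Finset.mem_univ _, leafSet_symm leaf d⟩
  weight_compl := by
    intro A hA
    obtain ⟨d, -, rfl⟩ := Finset.mem_image.1 hA
    rw [← leafSet_symm, (leafSet_injective leaf hess).extend_apply,
      (leafSet_injective leaf hess).extend_apply, dartWeight_symm]
  compat := by
    intro A B hA hB
    obtain ⟨d, -, rfl⟩ := Finset.mem_image.1 hA
    obtain ⟨e, -, rfl⟩ := Finset.mem_image.1 hB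
    rcases side_compat d e with h | h | h | h
    · exact .inl fun i hi => (mem_leafSet leaf).2 (h ((mem_leafSet leaf).1 hi))
    · exact .inr (.inl fun i hi => (mem_leafSet leaf).2 (h ((mem_leafSet leaf).1 hi)))
    · exact .inr (.inr (.inl (Finset.disjoint_left.2 fun i hi hi' =>
        Set.disjoint_left.1 h ((mem_leafSet leaf).1 hi) ((mem_leafSet leaf).1 hi'))))
    · refine .inr (.inr (.inr (Finset.disjoint_left.2 fun i hi hi' => ?_)))
      rw [Finset.mem_compl, mem_leafSet] at hi hi'
      exact Set.disjoint_left.1 h hi hi'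
  singleton_mem := by
    intro i
    obtain ⟨d, hd⟩ := exists_fst_eq leaf i
    exact Finset.mem_image.2 ⟨d, Finset.mem_univ _, leafSet_of_fst_eq leaf hd⟩
  nonempty := by
    intro A hA
    obtain ⟨d, -, rfl⟩ := Finset.mem_image.1 hA
    exact leafSet_nonempty leaf d
  weight_ne_zero := by
    intro A hA h2 h2'
    obtain ⟨d, -, rfl⟩ := Finset.mem_image.1 hA
    rw [(leafSet_injective leaf hess).extend_apply]
    -- An edge of a twig ends in a leaf, so one of its parts would be a singleton.
    refine hnz _ ?_
    rintro ⟨N, F, p, hp, he⟩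
    have he := hess.eq_mk_of_mem_edges_of_isTwig hp he
    have hF : F = leaf (leaf.symm ⟨F, hp.1⟩) := by simp
    rcases (dart_edge_eq_mk'_iff' (d := d)).1 he with ⟨-, h⟩ | ⟨h, -⟩
    · rw [← leafSet_symm, leafSet_of_fst_eq leaf (d := d.symm) (h.trans hF)] at h2'
      simp at h2'
    · rw [leafSet_of_fst_eq leaf (h.trans hF)] at h2
      simp at h2

theorem mem_splitSystem_sets {A : Finset (Fin n)} :
    A ∈ (splitSystem leaf hess hnz).sets ↔ ∃ d, leafSet leaf d = A := by
  simp [splitSystem]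

theorem splitSystem_weight (d : T.graph.Dart) :
    (splitSystem leaf hess hnz).weight (leafSet leaf d) = dartWeight d :=
  (leafSet_injective leaf hess).extend_apply _ _ _

theorem splitSystem_value {I : Finset (Fin n)} (hI : I.Nonempty) :
    (splitSystem leaf hess hnz).value I =
      2 * T.multiweight ((fun i => (leaf i : V)) '' I) := by
  classical
  rw [two_mul_multiweight ((Finset.coe_nonempty.2 hI).image _), SplitSystem.value]
  have : (splitSystem leaf hess hnz).sets = Finset.univ.image (leafSet leaf) := by
    ext A
    rw [mem_splitSystem_sets]
    simp
  rw [this, Finset.sum_image (fun a _ b _ h => leafSet_injective leaf hess h)]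
  refine Finset.sum_congr rfl fun d _ => ?_
  rw [splitSystem_weight]
  congr 1
  simp only [Finset.not_disjoint_iff, Finset.mem_compl, mem_leafSet, Set.exists_mem_image,
    Finset.mem_coe]

end SplitSystem

/-! ### Rebuilding the tree from its splits. -/

/-- The leaf sets of the sides that contain the vertex `v`. -/
def code (v : V) : Set (Finset (Fin n)) := {A | ∃ d, leafSet leaf d = A ∧ v ∈ T.side d}

section

variable [Finite V]

theorem leafSet_mem_code (hess : T.IsEssential) {d : T.graph.Dart} {v : V} :
    leafSet leaf d ∈ code leaf v ↔ v ∈ T.side d := by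
  refine ⟨?_, fun h => ⟨d, rfl, h⟩⟩
  rintro ⟨e, he, h⟩
  rwa [leafSet_injective leaf hess he] at h

theorem code_injective (hess : T.IsEssential) : Function.Injective (code leaf) := by
  intro u v h
  by_contra hne
  obtain ⟨d, rfl, hv⟩ := exists_dart_of_ne (T := T) hne
  rw [← leafSet_mem_code leaf hess, ← h, leafSet_mem_code leaf hess] at hv
  exact hv (fst_mem_side d)

theorem code_fst_diff (hess : T.IsEssential) (d : T.graph.Dart) :
    code leaf d.fst \ code leaf d.snd = {leafSet leaf d} := by
  ext A
  rw [Set.mem_sdiff, Set.mem_singleton_iff]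
  constructor
  · rintro ⟨⟨e, rfl, h⟩, h'⟩
    rw [leafSet_mem_code leaf hess] at h'
    by_cases he : d.edge = e.edge
    · rcases dart_edge_eq_iff d e |>.1 he with rfl | rfl
      · rfl
      · exact absurd h (snd_notMem_side e)
    · exact absurd (mem_side_of_adj h d.adj he) h'
  · rintro rfl
    rw [leafSet_mem_code leaf hess, leafSet_mem_code leaf hess]
    exact ⟨fst_mem_side d, snd_notMem_side d⟩

/-- Every edge on the path from `u` to `v` contributes a different part to the difference, so a
single part means a path of length one. -/
theorem adj_iff_code (hess : T.IsEssential) {u v : V} :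
    T.graph.Adj u v ↔ ∃ A, code leaf u \ code leaf v = {A} := by
  refine ⟨fun h => ⟨_, code_fst_diff leaf hess ⟨(u, v), h⟩⟩, ?_⟩
  rintro ⟨A, hA⟩
  have hne : u ≠ v := by
    rintro rfl
    rw [Set.sdiff_self] at hA
    exact (Set.singleton_ne_empty A).symm hA
  obtain ⟨d, rfl, hv⟩ := exists_dart_of_ne (T := T) hne
  rcases eq_or_ne d.snd v with rfl | hne'
  · exact d.adj
  exfalso
  obtain ⟨e, he, hv'⟩ := exists_dart_of_ne (T := T) hne'
  have hmem : ∀ f : T.graph.Dart, d.fst ∈ T.side f → v ∉ T.side f → leafSet leaf f = A := by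
    intro f h1 h2
    have : leafSet leaf f ∈ code leaf d.fst \ code leaf v :=
      ⟨(leafSet_mem_code leaf hess).2 h1, fun h => h2 ((leafSet_mem_code leaf hess).1 h)⟩
    rwa [hA] at this
  have hed : d.fst ∈ T.side e := by
    refine mem_side_of_adj (he ▸ fst_mem_side e) d.adj.symm fun h => ?_
    rcases dart_edge_eq_iff d.symm e |>.1 h with rfl | h
    · exact hv' (mem_side_symm.2 hv)
    · exact d.adj.ne' (he.symm.trans (congrArg (·.fst) (Dart.symm_involutive.injective h)).symm)
  have := leafSet_injective leaf hess
    ((hmem d (fst_mem_side d) hv).trans (hmem e hed hv').symm)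
  subst this
  exact d.adj.ne he

/-- This describes the vertices through the leaf sets alone, so trees with the same splits have the
same codes. A consistent choice orients every edge, and all orientations point to one vertex. -/
theorem mem_range_code_iff (hess : T.IsEssential) (F : Set (Finset (Fin n))) :
    F ∈ Set.range (code leaf) ↔
    (∀ A ∈ F, A ∈ Set.range (leafSet leaf)) ∧ (∀ A ∈ Set.range (leafSet leaf), Aᶜ ∈ F ↔ A ∉ F) ∧
      ∀ A ∈ F, ∀ B ∈ F, (A ∩ B).Nonempty := by
  constructor
  · rintro ⟨v, rfl⟩
    refine ⟨fun A ⟨d, hd, _⟩ => ⟨d, hd⟩, ?_, ?_⟩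
    · rintro _ ⟨d, rfl⟩
      rw [← leafSet_symm, leafSet_mem_code leaf hess, leafSet_mem_code leaf hess, mem_side_symm]
    · rintro _ ⟨d, rfl, hd⟩ _ ⟨e, rfl, he⟩
      exact leafSet_inter_nonempty leaf hess hd he
  · rintro ⟨h1, h2, h3⟩
    have h2 : ∀ d : T.graph.Dart, leafSet leaf d.symm ∈ F ↔ leafSet leaf d ∉ F := fun d => by
      rw [leafSet_symm]; exact h2 _ ⟨d, rfl⟩
    suffices ∃ v, ∀ d : T.graph.Dart, leafSet leaf d ∈ F → v ∈ T.side d by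
      obtain ⟨v, hv⟩ := this
      refine ⟨v, Set.ext fun A => ⟨?_, fun hA => ?_⟩⟩
      · rintro ⟨d, rfl, hd⟩
        by_contra hF
        exact mem_side_symm.1 (hv _ ((h2 d).2 hF)) hd
      · obtain ⟨d, rfl⟩ := h1 A hA
        exact ⟨d, rfl, hv d hA⟩
    have : Finite T.graph.Dart := Finite.of_injective _ Dart.toProd_injective
    -- A chosen side of least size has the wanted vertex as its `fst`: a chosen side missing it
    -- would be strictly smaller, disjoint from it, or its complement.
    by_cases hne : {d : T.graph.Dart | leafSet leaf d ∈ F}.Nonempty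
    · obtain ⟨d, hd, hmin⟩ := Set.exists_min_image _ (fun d => (T.side d).ncard)
        (Set.toFinite _) hne
      refine ⟨d.fst, fun e he => ?_⟩
      by_contra hde
      have hds : d.snd ∉ T.side e := fun h => by
        have : d.symm.edge = e.edge := by
          by_contra hne
          exact hde (mem_side_of_adj h d.adj.symm hne)
        rcases dart_edge_eq_iff d.symm e |>.1 this with rfl | h'
        · exact (h2 d).1 he hd
        · exact hde (Dart.symm_involutive.injective h' ▸ fst_mem_side d)
      by_cases hef : e.fst ∈ T.side d
      · refine (hmin e he).not_gt (Set.ncard_lt_ncard ?_ (Set.toFinite _))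
        exact (side_subset hef hds).ssubset_of_mem_notMem (fst_mem_side d) hde
      · obtain ⟨i, hi⟩ := h3 _ hd _ he
        rw [Finset.mem_inter, mem_leafSet, mem_leafSet] at hi
        exact mem_side_symm.1 (side_subset (e := d.symm) (mem_side_symm.2 hef) hde hi.2) hi.1
    · obtain ⟨v⟩ := T.isTree.connected.nonempty
      exact ⟨v, fun d hd => absurd ⟨d, hd⟩ hne⟩

end

end WeightedTree

/-! ### The isomorphism. -/

open WeightedTree

theorem mainTheorem2 {V V' : Type*} [Finite V] [Finite V'] (n k : ℕ) (hk : 3 ≤ k)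
    (hkn : 2 * k ≤ n + 1) (T : WeightedTree V) (T' : WeightedTree V')
    (leaf : Fin n ≃ {v : V // T.IsLeaf v}) (leaf' : Fin n ≃ {v : V' // T'.IsLeaf v})
    (hess : T.IsEssential) (hess' : T'.IsEssential)
    (hnz : T.IsInternalNonzero) (hnz' : T'.IsInternalNonzero)
    (hD : ∀ I : Finset (Fin n), I.card = k →
      T.multiweight ((fun i => (leaf i : V)) '' I) =
        T'.multiweight ((fun i => (leaf' i : V')) '' I)) :
    ∃ φ : T.graph ≃g T'.graph,
      (∀ i, φ (leaf i) = leaf' i) ∧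
      ∀ e : T.graph.edgeSet, T'.weight (φ.mapEdgeSet e) = T.weight e := by
  have := Fintype.ofFinite V
  have := Fintype.ofFinite V'
  obtain ⟨hs, hw⟩ := SplitSystem.eq_of_value_eq (S := splitSystem leaf hess hnz)
    (S' := splitSystem leaf' hess' hnz') hk (by rwa [Fintype.card_fin]) fun I hI => by
      have hne : I.Nonempty := Finset.card_pos.1 (by omega)
      rw [splitSystem_value leaf hess hnz hne, splitSystem_value leaf' hess' hnz' hne, hD I hI]
  have hrange : Set.range (leafSet leaf) = Set.range (leafSet leaf') := by
    ext A
    rw [Set.mem_range, Set.mem_range, ← mem_splitSystem_sets leaf hess hnz, hs,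
      mem_splitSystem_sets]
  have hcode : Set.range (code leaf) = Set.range (code leaf') := by
    ext F
    rw [mem_range_code_iff leaf hess, mem_range_code_iff leaf' hess', hrange]
  -- Vertices with equal codes are matched.
  let φ : V ≃ V' := (Equiv.ofInjective _ (code_injective leaf hess)).trans
    ((Equiv.setCongr hcode).trans (Equiv.ofInjective _ (code_injective leaf' hess')).symm)
  have hφ : ∀ v, code leaf' (φ v) = code leaf v := fun v =>
    Equiv.apply_ofInjective_symm (code_injective leaf' hess') _
  let ψ : T.graph ≃g T'.graph := ⟨φ, fun {u v} => by
    rw [adj_iff_code leaf hess, adj_iff_code leaf' hess', hφ, hφ]⟩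
  refine ⟨ψ, fun i => code_injective leaf' hess' ?_, ?_⟩
  · have key : ∀ A, A ∈ code leaf (leaf i : V) ↔ A ∈ Set.range (leafSet leaf) ∧ i ∈ A := by
      intro A
      constructor
      · rintro ⟨d, rfl, hd⟩
        exact ⟨⟨d, rfl⟩, (mem_leafSet leaf).2 hd⟩
      · rintro ⟨⟨d, rfl⟩, hi⟩
        exact ⟨d, rfl, (mem_leafSet leaf).1 hi⟩
    have key' : ∀ A, A ∈ code leaf' (leaf' i : V') ↔ A ∈ Set.range (leafSet leaf') ∧ i ∈ A := by
      intro A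
      constructor
      · rintro ⟨d, rfl, hd⟩
        exact ⟨⟨d, rfl⟩, (mem_leafSet leaf').2 hd⟩
      · rintro ⟨⟨d, rfl⟩, hi⟩
        exact ⟨d, rfl, (mem_leafSet leaf').1 hi⟩
    refine (hφ _).trans (Set.ext fun A => ?_)
    rw [key, key', hrange]
  · rintro ⟨e, he⟩
    induction e with
    | h u v =>
      let d : T.graph.Dart := ⟨(u, v), he⟩
      let d' : T'.graph.Dart := ⟨(φ u, φ v), ψ.map_rel_iff.2 he⟩
      have h1 := code_fst_diff leaf hess d
      have h2 := code_fst_diff leaf' hess' d'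
      -- The part of a dart is the difference of the codes of its ends, which `φ` preserves.
      have h3 : leafSet leaf' d' = leafSet leaf d := by
        rw [← Set.singleton_eq_singleton_iff, ← h1, ← h2]
        change code leaf' (φ u) \ code leaf' (φ v) = _
        rw [hφ, hφ]
      have h4 := hw (leafSet leaf d) ((mem_splitSystem_sets leaf hess hnz).2 ⟨d, rfl⟩)
      rw [splitSystem_weight, ← h3, splitSystem_weight] at h4
      exact h4.symm
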